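/- Let $p$ be a prime, $q=p^h$, and let $F/\mathbb{F}_q$ be an algebraic function field of one variable with constant field $\mathbb{F}_q$. Let $P$ be a rational place of $F$, let $\sigma\in\mathrm{Aut}(F/\mathbb{F}_q)$, put $P_i=\sigma^i(P)$ for $i\in\mathbb{Z}$, and let $n$ be the smallest positive integer with $\sigma^n(P)=P$. Let $z\in F$ satisfy $v_{P_i}(z)\ge 0$ for all $i$, and consider the sequence over $\mathbb{F}_p\subseteq\mathbb{F}_q$ $$\mathbf{s}_z=(s_0,\dots,s_{n-1}),\qquad s_i=\mathrm{Tr}_{\mathbb{F}_q/\mathbb{F}_p}(z(P_i)).$$ Assume that $z$ has exactly one pole $Q$, that $\gcd(v_Q(z),p)=1$, and that the places $Q,\sigma(Q),\dots,\sigma^{n-1}(Q)$ are pairwise distinct. For a place $R$ and $f\in F$ let $m_R(f)=\max(0,-v_R(f))$ be the order of the pole of $f$ at $R$ (zero if $f$ is regular at $R$), and let $m_R^*(f)=\min\{m_R(f-(x-x^p)) : x\in F\}$ be the reduced pole order. For an integer $m\ge 0$ the $m$-th order nonlinear complexity $\mathrm{NL}_m(\mathbf{s})$ of a nonzero sequence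 $\mathbf{s}=(s_0,\dots,s_{n-1})$ is the least positive integer $L$ for which there is a polynomial $\Phi\in\mathbb{F}_q[x_1,\dots,x_L]$ of total degree at most $m$ with $s_{i+L}=\Phi(s_i,\dots,s_{i+L-1})$ for all $0\le i\le n-1-L$; for the zero sequence $\mathrm{NL}_m(\mathbf{s})=0$. Then, for every integer $m\ge 0$, $$\mathrm{NL}_m(\mathbf{s}_z)\ \ge\ \frac{n-p^{h-1}\,m_Q^*(z)\,d}{1+m\,p^{h-1}\,m_Q^*(z)\,d},$$ both for $d=\deg Q$ and for $d=\deg (z)_\infty$, the degree of the pole divisor of $z$. -/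

import Mathlib

noncomputable section

namespace FunctionFieldSeq

/-! ### Nonlinear complexity of a finite sequence -/

/-- The polynomial `Φ(x_1, …, x_L)` generates the sequence `s = (s_0, …, s_{N-1})`:
`s_{i+L} = Φ(s_i, …, s_{i+L-1})` for all `0 ≤ i ≤ N - 1 - L`. -/
def Generates {K : Type*} [Field K] {N L : ℕ} (Φ : MvPolynomial (Fin L) K) (s : Fin N → K) :
    Prop :=
  ∀ (i : ℕ) (hi : i + L < N),
    s ⟨i + L, hi⟩ = MvPolynomial.eval (fun j : Fin L => s ⟨i + j, by omega⟩) Φ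

open Classical in
/-- The `m`-th order nonlinear complexity of a finite sequence over a field `K`: zero for the zero
sequence, and otherwise the least positive `L` such that a polynomial over `K` in `L` variables
of total degree at most `m` generates the sequence. -/
def nonlinearComplexity {K : Type*} [Field K] {N : ℕ} (m : ℕ) (s : Fin N → K) : ℕ :=
  if s = 0 then 0
  else sInf {L : ℕ | 0 < L ∧ ∃ Φ : MvPolynomial (Fin L) K, Φ.totalDegree ≤ m ∧ Generates Φ s}

/-! ### Places of a function field -/

/-- A place of `F/k`, given by its valuation ring `𝒪_P`, a proper valuation subring of `F`
containing `k`.  (The maximal ideal `P` and the ring `𝒪_P` determine each other.) -/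
@[ext]
structure Place (k F : Type*) [Field k] [Field F] [Algebra k F] where
  /-- the valuation ring `𝒪_P` -/
  ring : ValuationSubring F
  algebraMap_mem : ∀ c : k, algebraMap k F c ∈ ring
  ne_top : ring ≠ ⊤

namespace Place

variable {k F : Type*} [Field k] [Field F] [Algebra k F]

instance instAlgebraRing (P : Place k F) : Algebra k P.ring :=
  ((algebraMap k F).codRestrict P.ring P.algebraMap_mem).toAlgebra

/-- The residue class field `F_P = 𝒪_P / P`. -/
abbrev resField (P : Place k F) : Type _ := IsLocalRing.ResidueField P.ring

/-- The degree `[F_P : k]` of a place. -/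
def degree (P : Place k F) : ℕ := Module.finrank k P.resField

/-- For `a ∈ 𝒪_P`, the largest `e` such that `a` lies in the `e`-th power of the maximal ideal
(and `0` for `a = 0`, where the set of exponents is unbounded). -/
def ordInt (P : Place k F) (a : P.ring) : ℕ :=
  sSup {e : ℕ | a ∈ IsLocalRing.maximalIdeal P.ring ^ e}

open Classical in
/-- The normalized discrete valuation `v_P` on nonzero elements of `F`: the order of `f` at `P` if
`f ∈ 𝒪_P`, and minus the order of `f⁻¹ ∈ 𝒪_P` otherwise.  (At `f = 0`, where the usual
convention is `v_P(0) = ∞`, it takes the value `0`.) -/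
def ord (P : Place k F) (f : F) : ℤ :=
  if hf : f ∈ P.ring then (P.ordInt ⟨f, hf⟩ : ℤ)
  else -(P.ordInt ⟨f⁻¹, (P.ring.mem_or_inv_mem f).resolve_left hf⟩ : ℤ)

open Classical in
/-- `m_P(f)`: zero if `f ∈ 𝒪_P`, and the order of the pole of `f` at `P` otherwise. -/
def poleOrder (P : Place k F) (f : F) : ℕ :=
  if f ∈ P.ring then 0 else (-P.ord f).toNat

/-- The reduced order of the pole of `f` at `P`,
`m_P^*(f) = min {m_P(f - g) | g = x - x^p, x ∈ F}`. -/
def reducedPoleOrder (p : ℕ) (P : Place k F) (f : F) : ℕ :=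
  sInf {e : ℕ | ∃ x : F, e = P.poleOrder (f - (x - x ^ p))}

/-- The image `σ(P)` of a place under an automorphism `σ` of `F/k`;
its valuation ring is `σ(𝒪_P)`. -/
def map (σ : F ≃ₐ[k] F) (P : Place k F) : Place k F where
  ring := P.ring.comap (σ.symm : F →+* F)
  algebraMap_mem c := by
    simpa [ValuationSubring.mem_comap] using P.algebraMap_mem c
  ne_top h := P.ne_top <| by
    rw [eq_top_iff]
    intro x _
    have hx : σ x ∈ P.ring.comap (σ.symm : F →+* F) := by rw [h]; trivial
    simpa [ValuationSubring.mem_comap] using hx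

lemma mem_map_ring (σ : F ≃ₐ[k] F) (P : Place k F) (f : F) :
    f ∈ (P.map σ).ring ↔ σ.symm f ∈ P.ring := Iff.rfl

open Classical in
/-- The value `f(P) ∈ k` of a function `f ∈ 𝒪_P` at a rational place `P`: the element of `k`
whose image in the residue field `F_P = k` is the residue class of `f`.
(It is `0` if there is no such element.) -/
def eval (P : Place k F) (f : F) : k :=
  if h : ∃ c : k, ∃ hf : f ∈ P.ring,
      algebraMap k P.resField c = IsLocalRing.residue P.ring ⟨f, hf⟩ then h.choose else 0

lemma algebraMap_eval (P : Place k F) (hP : P.degree = 1) (f : F) (hf : f ∈ P.ring) :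
    algebraMap k P.resField (P.eval f) = IsLocalRing.residue P.ring ⟨f, hf⟩ := by
  have h : ∃ c : k, ∃ hf : f ∈ P.ring,
      algebraMap k P.resField c = IsLocalRing.residue P.ring ⟨f, hf⟩ := by
    obtain ⟨c, hc⟩ := (finrank_eq_one_iff_of_nonzero' (1 : P.resField) one_ne_zero).1 hP
      (IsLocalRing.residue P.ring ⟨f, hf⟩)
    exact ⟨c, hf, by rw [Algebra.algebraMap_eq_smul_one, hc]⟩
  rw [eval, dif_pos h]
  exact h.choose_spec.2

end Place

variable {k F : Type*} [Field k] [Field F] [Algebra k F]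

/-- The degree of the pole divisor `(f)_∞ = ∑_P m_P(f) P`. -/
def poleDivisorDegree (k : Type*) {F : Type*} [Field k] [Field F] [Algebra k F] (f : F) : ℕ :=
  ∑ᶠ P : Place k F, P.poleOrder f * P.degree

/-- `s_z = (Tr(z(P_0)), Tr(z(P_1)), …, Tr(z(P_{n-1})))`, where `P_i = σ^i(P)` and `Tr` is the
absolute trace from `k` to `𝔽_p`. -/
def seqOf (p : ℕ) [Fact p.Prime] [Algebra (ZMod p) k] (σ : F ≃ₐ[k] F) (P : Place k F) (z : F)
    (n : ℕ) (i : Fin n) : ZMod p :=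
  Algebra.trace (ZMod p) k ((P.map (σ ^ (i : ℕ))).eval z)

end FunctionFieldSeq

end

/-!
Let `w = ∑_{i<h} z ^ (p ^ i)`, so that `w(P_i) = Tr(z(P_i)) = s_i`.  Its only pole is `Q`, of order
`c = p ^ (h-1) * m_Q(z)`.  If `Φ`, of degree at most `m`, generates the sequence from windows of
length `L < n`, then `W = σ⁻ᴸ w - Φ(w, σ⁻¹ w, …, σ¹⁻ᴸ w)` vanishes at `P_0, …, P_{n-1-L}`.  It is
not zero, because only its first term has a pole at `σ⁻ᴸ(Q)`, and its poles have total degree at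
most `(1 + L * m) * c * deg Q`.  A nonzero function has at most as many zeros as poles, so
`n - L ≤ (1 + L * m) * c * deg Q` (`le_of_generates`).  Since `v_Q(z)` is prime to `p`, the reduced
pole order of `z` at `Q` is not smaller than the pole order
(`Place.neg_ord_le_reducedPoleOrder`), and `deg (z)_∞ = m_Q(z) * deg Q ≥ deg Q`.

That zeros are at most as many as poles (`card_zeros_le`) comes from counting dimensions.  Elements
of a `k[x]`-submodule `M` of `F` that are independent modulo `xM` are independent over `k(x)`
(`eq_zero_of_sum_aeval_mul_eq_zero`).  With `M = 𝒪_P` this shows that `𝒪_P / x𝒪_P` has finite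
dimension, so `𝒪_P` is a discrete valuation ring and has a finite residue field extension.  With
`M` the intersection of the valuation rings of the zeros of `x`, weak approximation gives as many
elements `u_R` independent over `k(x)` as there are zeros `R`.  The functions `x ^ i * u_R` with
`i < l` then lie, after a scaling, in the Riemann–Roch space of a divisor of degree
`l * deg (x)_∞ + O(1)`, and `ℓ(D) ≤ deg D + 1` (`rank_riemannRochSpace_le`).
-/

noncomputable section

namespace FunctionFieldSeq

variable {k F : Type*} [Field k] [Field F] [Algebra k F]

section

open Polynomial IntermediateField IntermediateField.algebraAdjoinAdjoin


/-! ### Independence over `k(x)` -/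

/-- Let `M` be a `k`-subspace of `F` that is stable under multiplication by `x ≠ 0`.  Elements of
`M` that are linearly independent over `k` modulo `xM` satisfy no relation over `k[x]`: the
constant terms of the coefficients of a relation vanish, so it can be divided by `x` for ever. -/
theorem eq_zero_of_sum_aeval_mul_eq_zero {x : F} (hx : x ≠ 0) (M : Submodule k F)
    (hM : ∀ f ∈ M, x * f ∈ M) {ι : Type*} [Fintype ι] (u : ι → F) (hu : ∀ i, u i ∈ M)
    (hind : ∀ c : ι → k, (∃ f ∈ M, ∑ i, c i • u i = x * f) → c = 0)
    (φ : ι → k[X]) (hφ : ∑ i, aeval x (φ i) * u i = 0) : φ = 0 := by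
  have haeval : ∀ (q : k[X]), ∀ f ∈ M, aeval x q * f ∈ M := by
    intro q f hf
    induction q using Polynomial.induction_on' with
    | add a b ha hb => rw [map_add, add_mul]; exact M.add_mem ha hb
    | monomial n a =>
      rw [aeval_monomial, mul_assoc, ← Algebra.smul_def]
      refine M.smul_mem _ ?_
      induction n with
      | zero => simpa using hf
      | succ n ih => rw [pow_succ', mul_assoc]; exact hM _ ih
  have key : ∀ (n : ℕ) (φ : ι → k[X]), ∑ i, aeval x (φ i) * u i = 0 → ∀ i, X ^ n ∣ φ i := by
    intro n
    induction n with
    | zero => intro φ _ i; simp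
    | succ n ih =>
      intro φ hφ i
      have hdec : ∀ i, φ i = X * (φ i).divX + C ((φ i).coeff 0) := fun i =>
        (X_mul_divX_add _).symm
      have hsum : x * ∑ i, aeval x (φ i).divX * u i + ∑ i, (φ i).coeff 0 • u i = 0 := by
        rw [← hφ, Finset.mul_sum, ← Finset.sum_add_distrib]
        refine Finset.sum_congr rfl fun i _ => ?_
        conv_rhs => rw [hdec i]
        simp only [map_add, map_mul, aeval_X, aeval_C, Algebra.smul_def]
        ring
      have h0 : (fun i => (φ i).coeff 0) = 0 := by
        refine hind _ ⟨-∑ i, aeval x (φ i).divX * u i,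
          M.neg_mem (M.sum_mem fun i _ => haeval _ _ (hu i)), ?_⟩
        linear_combination hsum
      have h0' : ∀ i, (φ i).coeff 0 = 0 := fun i => congrFun h0 i
      have hdiv : ∑ i, aeval x (φ i).divX * u i = 0 := by
        simpa [h0', hx] using hsum
      rw [hdec i, h0' i, C_0, add_zero, pow_succ']
      exact mul_dvd_mul_left X (ih _ hdiv i)
  funext i
  by_contra hne
  have hle := natDegree_le_of_dvd (key ((φ i).natDegree + 1) φ hφ i) hne
  rw [natDegree_X_pow] at hle
  omega

/-- The dimension over `k` of `M / xM` is at most `[F : k(x)]`. -/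
theorem card_le_finrank_adjoin {x : F} (hx : x ≠ 0) [FiniteDimensional k⟮x⟯ F]
    (M : Submodule k F) (hM : ∀ f ∈ M, x * f ∈ M) {ι : Type*} [Fintype ι] (u : ι → F)
    (hu : ∀ i, u i ∈ M)
    (hind : ∀ c : ι → k, (∃ f ∈ M, ∑ i, c i • u i = x * f) → c = 0) :
    Fintype.card ι ≤ Module.finrank k⟮x⟯ F := by
  refine LinearIndependent.fintype_card_le_finrank (b := u) ?_
  rw [← LinearIndependent.iff_fractionRing (Algebra.adjoin k {x}), Fintype.linearIndependent_iff]
  intro g hg i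
  have hrep : ∀ i, ∃ q : k[X], aeval x q = (g i : F) := fun i =>
    (Algebra.adjoin_singleton_eq_range_aeval k x).le (g i).2
  choose q hq using hrep
  have hq0 : q = 0 := by
    refine eq_zero_of_sum_aeval_mul_eq_zero hx M hM u hu hind q ?_
    rw [← hg]
    exact Finset.sum_congr rfl fun i _ => by rw [hq i]; rfl
  apply Subtype.ext
  rw [← hq i, hq0]
  simp

namespace Place

/-! ### Places are discrete, with finite residue extensions -/

/-- Elements of `F` that are algebraic over `k` and nonzero are units at every place. -/
theorem transcendental_of_mem_nonunits (P : Place k F) {x : F} (hx0 : x ≠ 0)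
    (hx : x ∈ P.ring.nonunits) : Transcendental k x := by
  intro halg
  have hint : IsIntegral P.ring x⁻¹ := halg.inv.isIntegral.map_of_comp_eq
    (algebraMap k P.ring) (RingHom.id F) (by ext; rfl)
  obtain ⟨y, hy⟩ := IsIntegrallyClosed.isIntegral_iff.1 hint
  rw [ValuationSubring.mem_nonunits_iff_or] at hx
  exact hx.resolve_left hx0 (hy ▸ y.2)

theorem mem_ring_of_isIntegral_adjoin (R : Place k F) {x f : F} (hx : x ∈ R.ring)
    (hf : IsIntegral (Algebra.adjoin k {x}) f) : f ∈ R.ring := by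
  have hle : ∀ a ∈ Algebra.adjoin k {x}, a ∈ R.ring := by
    intro a ha
    induction ha using Algebra.adjoin_induction with
    | mem y hy => rw [Set.mem_singleton_iff.1 hy]; exact hx
    | algebraMap c => exact R.algebraMap_mem c
    | add _ _ _ _ h1 h2 => exact R.ring.add_mem _ _ h1 h2
    | mul _ _ _ _ h1 h2 => exact R.ring.mul_mem _ _ h1 h2
  let ψ : Algebra.adjoin k {x} →+* R.ring :=
    (algebraMap (Algebra.adjoin k {x}) F).codRestrict R.ring fun a => hle a a.2
  obtain ⟨y, hy⟩ := IsIntegrallyClosed.isIntegral_iff.1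
    (hf.map_of_comp_eq ψ (RingHom.id F) (by ext; rfl) : IsIntegral R.ring f)
  have hy' : (y : F) = f := hy
  exact hy' ▸ y.2

theorem exists_mem_nonunits_ne_zero (P : Place k F) : ∃ x ∈ P.ring.nonunits, x ≠ 0 := by
  by_contra! h
  refine P.ne_top (eq_top_iff.2 fun x _ => ?_)
  by_contra hx
  have hx0 : x ≠ 0 := by rintro rfl; exact hx P.ring.zero_mem
  exact inv_ne_zero hx0 (h _ (P.ring.inv_mem_nonunits_iff.2 (Or.inr hx)))

theorem mul_mem_nonunits (P : Place k F) {a t : F} (ht : t ∈ P.ring.nonunits) (ha : a ∈ P.ring) :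
    t * a ∈ P.ring.nonunits := by
  rw [ValuationSubring.mem_nonunits_iff] at ht ⊢
  rw [map_mul]
  exact mul_lt_one_of_lt_of_le ht ((P.ring.valuation_le_one_iff a).2 ha)

/-- The valuation ring of a place as a `k`-subspace of `F`. -/
def toSubmodule (P : Place k F) : Submodule k F where
  carrier := P.ring
  add_mem' := P.ring.add_mem _ _
  zero_mem' := P.ring.zero_mem
  smul_mem' c f hf := by
    rw [Algebra.smul_def]
    exact P.ring.mul_mem _ _ (P.algebraMap_mem c) hf

variable [Algebra (RatFunc k) F] [IsScalarTower k (RatFunc k) F] [FunctionField k F]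

/-- Lifts of a `k`-basis of `𝒪_P / x𝒪_P` are independent over `k(x)`, and `[F : k(x)]` is finite
because `x` is transcendental. -/
theorem finite_quotient_span_singleton (P : Place k F) {x : P.ring} (hx0 : x ≠ 0)
    (hx : x ∈ IsLocalRing.maximalIdeal P.ring) :
    Module.Finite k (P.ring ⧸ Ideal.span {x}) := by
  have hx0' : (x : F) ≠ 0 := fun h => hx0 (Subtype.ext h)
  have htr : Transcendental k (x : F) :=
    P.transcendental_of_mem_nonunits hx0' (ValuationSubring.coe_mem_nonunits_iff.2 hx)
  have := FunctionField.finiteDimensional_of_adjoin_transcendental htr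
  refine Module.rank_lt_aleph0_iff.1 (lt_of_le_of_lt (rank_le
    (n := Module.finrank k⟮(x : F)⟯ F) fun s hs => ?_) (Cardinal.natCast_lt_aleph0))
  have hlift : ∀ i : s, ∃ a : P.ring, Ideal.Quotient.mk (Ideal.span {x}) a = i.1 :=
    fun i => Ideal.Quotient.mk_surjective i.1
  choose a ha using hlift
  rw [← Fintype.card_coe]
  refine card_le_finrank_adjoin hx0' P.toSubmodule
    (fun f hf => P.ring.mul_mem _ _ x.2 hf) (fun i => (a i : F)) (fun i => (a i).2) ?_
  rintro c ⟨f, hf, hcf⟩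
  rw [Fintype.linearIndependent_iff] at hs
  refine funext (hs c ?_)
  have hmk : ∑ i, c i • a i = x * ⟨f, hf⟩ := by
    apply Subtype.ext
    rw [← P.ring.coe_subtype, map_sum]
    refine Eq.trans (Finset.sum_congr rfl fun i _ => ?_) hcf
    rw [Algebra.smul_def, Algebra.smul_def]
    rfl
  have hzero : Ideal.Quotient.mk (Ideal.span {x}) (∑ i, c i • a i) = 0 := by
    rw [hmk, Ideal.Quotient.eq_zero_iff_mem]
    exact Ideal.mul_mem_right _ _ (Ideal.mem_span_singleton_self x)
  rw [← hzero, map_sum]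
  refine Finset.sum_congr rfl fun i _ => ?_
  rw [← ha i]
  exact (map_smul (Ideal.Quotient.mkₐ k (Ideal.span {x})) (c i) (a i)).symm

/-- The valuation ring of a place is Noetherian, since its quotients by nonzero principal ideals
have finite dimension over `k`; hence it is a discrete valuation ring. -/
theorem isDiscreteValuationRing (P : Place k F) : IsDiscreteValuationRing P.ring := by
  have hfield : ¬ IsField P.ring := by
    intro h
    obtain ⟨x, hx, hx0⟩ := P.exists_mem_nonunits_ne_zero
    obtain ⟨hxP, hxm⟩ := ValuationSubring.mem_nonunits_iff_exists_mem_maximalIdeal.1 hx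
    rw [IsLocalRing.isField_iff_maximalIdeal_eq.1 h, Ideal.mem_bot] at hxm
    exact hx0 (congrArg Subtype.val hxm)
  have hnoeth : IsNoetherianRing P.ring := by
    refine (isNoetherianRing_iff_ideal_fg _).2 fun I => ?_
    by_cases hI : I = ⊤
    · rw [hI]; exact ⟨{1}, by simp⟩
    by_cases hI0 : I = ⊥
    · rw [hI0]; exact Submodule.fg_bot
    obtain ⟨x, hxI, hx0⟩ := Submodule.exists_mem_ne_zero_of_ne_bot hI0
    have := P.finite_quotient_span_singleton hx0 (IsLocalRing.le_maximalIdeal hI hxI)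
    have hN : IsNoetherian P.ring (P.ring ⧸ Ideal.span {x}) :=
      isNoetherian_of_tower k inferInstance
    refine Submodule.fg_of_fg_map_of_fg_inf_ker (Submodule.mkQ (Ideal.span {x}))
      (hN.noetherian _) ?_
    rw [Submodule.ker_mkQ, inf_eq_right.2 ((Ideal.span_singleton_le_iff_mem I).2 hxI)]
    exact ⟨{x}, by simp⟩
  have hval : ValuationRing P.ring := inferInstance
  exact ((IsDiscreteValuationRing.TFAE P.ring hfield).out 0 1).2 hval

theorem finite_resField (P : Place k F) : Module.Finite k P.resField := by
  obtain ⟨x, hx, hx0⟩ := P.exists_mem_nonunits_ne_zero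
  obtain ⟨hxP, hxm⟩ := ValuationSubring.mem_nonunits_iff_exists_mem_maximalIdeal.1 hx
  have := P.finite_quotient_span_singleton (x := (⟨x, hxP⟩ : P.ring))
    (fun h => hx0 (congrArg Subtype.val h)) hxm
  have hle : Ideal.span {(⟨x, hxP⟩ : P.ring)} ≤ IsLocalRing.maximalIdeal P.ring :=
    (Ideal.span_singleton_le_iff_mem _).2 hxm
  exact Module.Finite.of_surjective
    (Ideal.Quotient.factorₐ k hle).toLinearMap
    (Ideal.Quotient.factor_surjective hle)

/-- The valuation rings of distinct places are incomparable. -/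
theorem eq_of_ring_le (P R : Place k F) (h : P.ring ≤ R.ring) : P = R := by
  have := P.isDiscreteValuationRing
  exact Place.ext (P.ring.eq_of_le_of_ne_top h R.ne_top)

end Place

end

section

namespace Place

/-! ### The normalized valuation -/

theorem coe_ne_zero_of_irreducible {A : ValuationSubring F} {ϖ : A} (h : Irreducible ϖ) :
    (ϖ : F) ≠ 0 := fun h0 => h.ne_zero (Subtype.ext h0)

theorem unit_mul_zpow_mem_ring_iff (P : Place k F) {ϖ : P.ring} (hϖ : Irreducible ϖ)
    (u : P.ringˣ) (n : ℤ) : ((u : P.ring) * (ϖ : F) ^ n) ∈ P.ring ↔ 0 ≤ n := by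
  have hunit : P.ring.valuation ((u : P.ring) : F) = 1 :=
    (ValuationSubring.valuation_eq_one_iff _ _).1 u.isUnit
  have hlt : P.ring.valuation (ϖ : F) < 1 :=
    (ValuationSubring.valuation_lt_one_iff _ _).1 hϖ.not_isUnit
  have hpos : 0 < P.ring.valuation (ϖ : F) := by
    rw [zero_lt_iff, Valuation.ne_zero_iff]; exact (coe_ne_zero_of_irreducible hϖ)
  rw [← ValuationSubring.valuation_le_one_iff, map_mul, hunit, one_mul, map_zpow₀]
  exact zpow_le_one_iff_right_of_lt_one₀ hpos hlt

theorem not_mem_ring_of_ord_neg (P : Place k F) {f : F} (h : P.ord f < 0) : f ∉ P.ring := by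
  intro hf
  rw [ord, dif_pos hf] at h
  omega

variable [Algebra (RatFunc k) F] [IsScalarTower k (RatFunc k) F] [FunctionField k F]

theorem exists_irreducible (P : Place k F) : ∃ ϖ : P.ring, Irreducible ϖ :=
  have := P.isDiscreteValuationRing
  IsDiscreteValuationRing.exists_irreducible P.ring

theorem exists_eq_mul_zpow (P : Place k F) {ϖ : P.ring} (hϖ : Irreducible ϖ) {f : F}
    (hf : f ≠ 0) : ∃ (n : ℤ) (u : P.ringˣ), f = (u : P.ring) * (ϖ : F) ^ n := by
  have := P.isDiscreteValuationRing
  exact IsDiscreteValuationRing.exists_units_eq_smul_zpow_of_irreducible hϖ hf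

theorem ordInt_unit_mul_pow (P : Place k F) {ϖ : P.ring} (hϖ : Irreducible ϖ) (u : P.ringˣ)
    (n : ℕ) : P.ordInt (u * ϖ ^ n) = n := by
  have := P.isDiscreteValuationRing
  have hset : {e : ℕ | (u * ϖ ^ n : P.ring) ∈ IsLocalRing.maximalIdeal P.ring ^ e} =
      Set.Iic n := by
    ext e
    rw [Set.mem_ofPred_eq, hϖ.maximalIdeal_eq, Ideal.span_singleton_pow,
      Ideal.mem_span_singleton, Units.dvd_mul_left, Set.mem_Iic,
      pow_dvd_pow_iff hϖ.ne_zero hϖ.not_isUnit]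
  rw [ordInt, hset, csSup_Iic]

theorem ord_unit_mul_zpow (P : Place k F) {ϖ : P.ring} (hϖ : Irreducible ϖ) (u : P.ringˣ)
    (n : ℤ) : P.ord ((u : P.ring) * (ϖ : F) ^ n) = n := by
  rw [ord]
  split_ifs with h
  · obtain ⟨a, rfl⟩ := Int.eq_ofNat_of_zero_le ((P.unit_mul_zpow_mem_ring_iff hϖ u n).1 h)
    have hmk : (⟨_, h⟩ : P.ring) = u * ϖ ^ a := Subtype.ext (by simp)
    rw [hmk, P.ordInt_unit_mul_pow hϖ]
  · obtain ⟨a, rfl⟩ : ∃ a : ℕ, n = -a := by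
      have := mt (P.unit_mul_zpow_mem_ring_iff hϖ u n).2 h
      exact ⟨n.natAbs, by omega⟩
    have hinv : (((u⁻¹ : P.ringˣ) : P.ring) : F) = ((u : P.ring) : F)⁻¹ :=
      eq_inv_of_mul_eq_one_left (congrArg Subtype.val u.inv_mul)
    have hmk : (⟨_, (P.ring.mem_or_inv_mem _).resolve_left h⟩ : P.ring) =
        (u⁻¹ : P.ringˣ) * ϖ ^ a := by
      apply Subtype.ext
      simp only [mul_inv, zpow_neg, inv_inv, zpow_natCast]
      push_cast
      rw [hinv]
    rw [hmk, P.ordInt_unit_mul_pow hϖ]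

theorem ord_mul (P : Place k F) {f g : F} (hf : f ≠ 0) (hg : g ≠ 0) :
    P.ord (f * g) = P.ord f + P.ord g := by
  obtain ⟨ϖ, hϖ⟩ := P.exists_irreducible
  obtain ⟨a, u, rfl⟩ := P.exists_eq_mul_zpow hϖ hf
  obtain ⟨b, v, rfl⟩ := P.exists_eq_mul_zpow hϖ hg
  rw [ord_unit_mul_zpow _ hϖ, ord_unit_mul_zpow _ hϖ, ← P.ord_unit_mul_zpow hϖ (u * v) (a + b),
    zpow_add₀ (coe_ne_zero_of_irreducible hϖ)]
  congr 1
  push_cast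
  ring

theorem mem_ring_iff (P : Place k F) {f : F} (hf : f ≠ 0) : f ∈ P.ring ↔ 0 ≤ P.ord f := by
  obtain ⟨ϖ, hϖ⟩ := P.exists_irreducible
  obtain ⟨a, u, rfl⟩ := P.exists_eq_mul_zpow hϖ hf
  rw [ord_unit_mul_zpow _ hϖ, unit_mul_zpow_mem_ring_iff _ hϖ]

theorem ord_one (P : Place k F) : P.ord 1 = 0 := by
  have := P.ord_mul (one_ne_zero (α := F)) one_ne_zero
  rw [one_mul] at this
  omega

theorem ord_pow (P : Place k F) {f : F} (hf : f ≠ 0) (n : ℕ) : P.ord (f ^ n) = n * P.ord f := by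
  induction n with
  | zero => simp [ord_one]
  | succ n ih =>
    rw [pow_succ, P.ord_mul (pow_ne_zero _ hf) hf, ih]
    push_cast
    ring

theorem ord_neg (P : Place k F) (f : F) : P.ord (-f) = P.ord f := by
  by_cases hf : f = 0
  · rw [hf, neg_zero]
  have h1 : P.ord (-1 : F) = 0 := by
    have := P.ord_mul (neg_ne_zero.2 (one_ne_zero (α := F))) (neg_ne_zero.2 one_ne_zero)
    rw [neg_mul_neg, one_mul, ord_one] at this
    omega
  rw [← neg_one_mul, P.ord_mul (neg_ne_zero.2 one_ne_zero) hf, h1, zero_add]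

theorem ord_inv (P : Place k F) {f : F} (hf : f ≠ 0) : P.ord f⁻¹ = -P.ord f := by
  have := P.ord_mul hf (inv_ne_zero hf)
  rw [mul_inv_cancel₀ hf, ord_one] at this
  omega

theorem le_ord_add (P : Place k F) {f g : F} (hf : f ≠ 0) (hg : g ≠ 0) (hfg : f + g ≠ 0)
    (h : P.ord f ≤ P.ord g) : P.ord f ≤ P.ord (f + g) := by
  have hgf : g * f⁻¹ ∈ P.ring := by
    rw [P.mem_ring_iff (mul_ne_zero hg (inv_ne_zero hf)), P.ord_mul hg (inv_ne_zero hf),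
      P.ord_inv hf]
    omega
  have hsum : (f + g) * f⁻¹ ∈ P.ring := by
    rw [add_mul, mul_inv_cancel₀ hf]
    exact P.ring.add_mem _ _ P.ring.one_mem hgf
  rw [P.mem_ring_iff (mul_ne_zero hfg (inv_ne_zero hf)), P.ord_mul hfg (inv_ne_zero hf),
    P.ord_inv hf] at hsum
  omega

theorem ord_add_eq_of_lt (P : Place k F) {f g : F} (hf : f ≠ 0) (hg : g ≠ 0)
    (h : P.ord f < P.ord g) : P.ord (f + g) = P.ord f := by
  have hfg : f + g ≠ 0 := by
    intro h0
    rw [eq_neg_of_add_eq_zero_left h0, ord_neg] at h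
    exact lt_irrefl _ h
  have h1 := P.le_ord_add hf hg hfg h.le
  refine le_antisymm (not_lt.1 fun hlt => ?_) h1
  -- otherwise `f = (f + g) - g` would have a larger order than `f`
  have hg' : -g ≠ 0 := neg_ne_zero.2 hg
  have hf' : (f + g) + -g = f := by ring
  rcases le_total (P.ord (f + g)) (P.ord (-g)) with hle | hle
  · have := P.le_ord_add hfg hg' (by rwa [hf']) hle
    rw [hf'] at this
    omega
  · have := P.le_ord_add hg' hfg (by rwa [add_comm, hf']) hle
    rw [add_comm, hf', ord_neg] at this
    omega

theorem ord_neg_of_not_mem_ring (P : Place k F) {f : F} (h : f ∉ P.ring) : P.ord f < 0 := by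
  have hf : f ≠ 0 := by rintro rfl; exact h P.ring.zero_mem
  rw [P.mem_ring_iff hf] at h
  omega

theorem mem_ring_of_ord_nonneg (P : Place k F) {f : F} (h : 0 ≤ P.ord f) : f ∈ P.ring := by
  by_contra hf
  have := P.ord_neg_of_not_mem_ring hf
  omega

theorem poleOrder_eq_zero_iff (P : Place k F) (f : F) : P.poleOrder f = 0 ↔ f ∈ P.ring := by
  rw [poleOrder]
  split_ifs with h
  · simp [h]
  · have := P.ord_neg_of_not_mem_ring h
    simp only [h, iff_false]
    omega

/-- A pole order prime to `p` is not lowered by subtracting `x - x ^ p`: the pole order of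
`x - x ^ p` is zero or divisible by `p`, so no cancellation of leading terms occurs. -/
theorem neg_ord_le_reducedPoleOrder {p : ℕ} (hp : p.Prime) (P : Place k F) (f : F)
    (hf : P.ord f < 0) (hcop : Int.gcd (P.ord f) p = 1) :
    -P.ord f ≤ P.reducedPoleOrder p f := by
  have hf0 : f ≠ 0 := by
    rintro rfl
    exact P.not_mem_ring_of_ord_neg hf P.ring.zero_mem
  have key : ∀ x : F, P.ord (f - (x - x ^ p)) ≤ P.ord f := by
    intro x
    by_cases hy0 : x - x ^ p = 0
    · rw [hy0, sub_zero]
    have hny0 : -(x - x ^ p) ≠ 0 := neg_ne_zero.2 hy0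
    rw [sub_eq_add_neg f]
    by_cases hx : x ∈ P.ring
    · have hy : x - x ^ p ∈ P.ring := sub_mem hx (pow_mem hx p)
      rw [P.mem_ring_iff hy0] at hy
      rw [P.ord_add_eq_of_lt hf0 hny0 (by rw [ord_neg]; omega)]
    · have hx0 : x ≠ 0 := by rintro rfl; exact hx P.ring.zero_mem
      have hxo := P.ord_neg_of_not_mem_ring hx
      have hp2 : (2 : ℤ) ≤ p := by exact_mod_cast hp.two_le
      have hyo : P.ord (-(x - x ^ p)) = p * P.ord x := by
        rw [ord_neg, sub_eq_neg_add, P.ord_add_eq_of_lt (neg_ne_zero.2 (pow_ne_zero _ hx0)) hx0,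
          ord_neg, P.ord_pow hx0]
        rw [ord_neg, P.ord_pow hx0]
        nlinarith
      rcases lt_trichotomy (P.ord f) (P.ord (-(x - x ^ p))) with h | h | h
      · rw [P.ord_add_eq_of_lt hf0 hny0 h]
      · rw [h, hyo] at hcop
        have hdvd : (p : ℤ) ∣ Int.gcd (p * P.ord x) p :=
          Int.dvd_coe_gcd (dvd_mul_right _ _) dvd_rfl
        rw [hcop] at hdvd
        exact absurd (Int.natCast_dvd_natCast.1 hdvd) hp.not_dvd_one
      · rw [add_comm, P.ord_add_eq_of_lt hny0 hf0 h]
        exact h.le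
  obtain ⟨x, hx⟩ : P.reducedPoleOrder p f ∈ {e : ℕ | ∃ x : F, e = P.poleOrder (f - (x - x ^ p))} :=
    Nat.sInf_mem ⟨_, 0, rfl⟩
  have hneg : P.ord (f - (x - x ^ p)) < 0 := (key x).trans_lt hf
  rw [hx, poleOrder, if_neg (P.not_mem_ring_of_ord_neg hneg)]
  have := key x
  omega

end Place

end

section

/-! ### Riemann–Roch spaces of effective divisors -/

namespace Place

/-- `v_P(f) ≥ -n`, stated without reference to a uniformizer: multiplication by the `n`-th power
of any nonzero element of the maximal ideal makes `f` regular at `P`. -/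
def HasPoleOrderLE (P : Place k F) (n : ℕ) (f : F) : Prop :=
  ∀ t ∈ P.ring.nonunits, t ≠ 0 → t ^ n * f ∈ P.ring

theorem hasPoleOrderLE_zero_iff (P : Place k F) (f : F) : P.HasPoleOrderLE 0 f ↔ f ∈ P.ring := by
  refine ⟨fun h => ?_, fun h t _ _ => by simpa using h⟩
  obtain ⟨t, ht, ht0⟩ := P.exists_mem_nonunits_ne_zero
  simpa using h t ht ht0

theorem hasPoleOrderLE_of_mem_ring (P : Place k F) (n : ℕ) {f : F} (hf : f ∈ P.ring) :
    P.HasPoleOrderLE n f :=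
  fun _ ht _ => P.ring.mul_mem _ _ (pow_mem (ValuationSubring.nonunits_subset ht) n) hf

namespace HasPoleOrderLE

variable {P : Place k F} {n m : ℕ} {f g : F}

theorem mono (hf : P.HasPoleOrderLE n f) (h : n ≤ m) : P.HasPoleOrderLE m f := by
  intro t ht ht0
  obtain ⟨a, rfl⟩ := Nat.exists_eq_add_of_le h
  rw [pow_add, mul_comm (t ^ n), mul_assoc]
  exact P.ring.mul_mem _ _ (pow_mem (ValuationSubring.nonunits_subset ht) a) (hf t ht ht0)

theorem add (hf : P.HasPoleOrderLE n f) (hg : P.HasPoleOrderLE n g) :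
    P.HasPoleOrderLE n (f + g) := by
  intro t ht ht0
  rw [mul_add]
  exact P.ring.add_mem _ _ (hf t ht ht0) (hg t ht ht0)

theorem mul (hf : P.HasPoleOrderLE n f) (hg : P.HasPoleOrderLE m g) :
    P.HasPoleOrderLE (n + m) (f * g) := by
  intro t ht ht0
  rw [pow_add, mul_mul_mul_comm]
  exact P.ring.mul_mem _ _ (hf t ht ht0) (hg t ht ht0)

end HasPoleOrderLE

end Place

open Classical in
/-- The Riemann–Roch space `L(D)` of an effective divisor `D`, which is encoded as a multiset of
places. -/
def riemannRochSpace (D : Multiset (Place k F)) : Submodule k F where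
  carrier := {f | ∀ R : Place k F, R.HasPoleOrderLE (D.count R) f}
  add_mem' hf hg R := (hf R).add (hg R)
  zero_mem' R := R.hasPoleOrderLE_of_mem_ring _ R.ring.zero_mem
  smul_mem' c f hf R := by
    have h := ((R.hasPoleOrderLE_zero_iff _).2 (R.algebraMap_mem c)).mul (hf R)
    rwa [zero_add, ← Algebra.smul_def] at h

/-- The degree of an effective divisor. -/
def divisorDegree (D : Multiset (Place k F)) : ℕ := (D.map Place.degree).sum

@[simp] theorem divisorDegree_add (D E : Multiset (Place k F)) :
    divisorDegree (D + E) = divisorDegree D + divisorDegree E := by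
  simp [divisorDegree]

@[simp] theorem divisorDegree_nsmul (n : ℕ) (D : Multiset (Place k F)) :
    divisorDegree (n • D) = n * divisorDegree D := by
  simp [divisorDegree, Multiset.map_nsmul, Multiset.sum_nsmul]

@[simp] theorem divisorDegree_singleton (R : Place k F) : divisorDegree {R} = R.degree := by
  simp [divisorDegree]

theorem divisorDegree_sum {ι : Type*} (s : Finset ι) (D : ι → Multiset (Place k F)) :
    divisorDegree (∑ i ∈ s, D i) = ∑ i ∈ s, divisorDegree (D i) := by
  classical
  induction s using Finset.induction_on with
  | empty => simp [divisorDegree]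
  | insert a s ha ih =>
    rw [Finset.sum_insert ha, Finset.sum_insert ha, divisorDegree_add, ih]

section RiemannRochSpace

variable {D E : Multiset (Place k F)} {f g : F}

open Classical in
theorem mem_riemannRochSpace :
    f ∈ riemannRochSpace D ↔ ∀ R : Place k F, R.HasPoleOrderLE (D.count R) f := Iff.rfl

theorem mem_riemannRochSpace_zero :
    f ∈ riemannRochSpace (0 : Multiset (Place k F)) ↔ ∀ R : Place k F, f ∈ R.ring := by
  simp only [mem_riemannRochSpace, Multiset.count_zero, Place.hasPoleOrderLE_zero_iff]

theorem riemannRochSpace_mono (h : D ≤ E) : riemannRochSpace D ≤ riemannRochSpace E := by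
  classical
  exact fun f hf R => (hf R).mono (Multiset.count_le_of_le R h)

theorem mul_mem_riemannRochSpace (hf : f ∈ riemannRochSpace D) (hg : g ∈ riemannRochSpace E) :
    f * g ∈ riemannRochSpace (D + E) := by
  classical
  intro R
  rw [Multiset.count_add]
  exact (hf R).mul (hg R)

theorem algebraMap_mem_riemannRochSpace (c : k) : algebraMap k F c ∈ riemannRochSpace D :=
  fun R => R.hasPoleOrderLE_of_mem_ring _ (R.algebraMap_mem c)

theorem pow_mem_riemannRochSpace (hf : f ∈ riemannRochSpace D) (n : ℕ) :
    f ^ n ∈ riemannRochSpace (n • D) := by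
  induction n with
  | zero => simpa using algebraMap_mem_riemannRochSpace (D := (0 : Multiset (Place k F))) (1 : k)
  | succ n ih =>
    rw [pow_succ, succ_nsmul]
    exact mul_mem_riemannRochSpace ih hf

theorem prod_mem_riemannRochSpace {ι : Type*} (s : Finset ι) (f : ι → F)
    (D : ι → Multiset (Place k F)) (hf : ∀ i ∈ s, f i ∈ riemannRochSpace (D i)) :
    ∏ i ∈ s, f i ∈ riemannRochSpace (∑ i ∈ s, D i) := by
  classical
  induction s using Finset.induction_on with
  | empty => simpa using algebraMap_mem_riemannRochSpace (D := (0 : Multiset (Place k F))) (1 : k)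
  | insert a s ha ih =>
    rw [Finset.prod_insert ha, Finset.sum_insert ha]
    exact mul_mem_riemannRochSpace (hf a (Finset.mem_insert_self a s))
      (ih fun i hi => hf i (Finset.mem_insert_of_mem hi))

theorem aeval_mem_riemannRochSpace {x : F} (hx : x ∈ riemannRochSpace D)
    {l : ℕ} {q : Polynomial k} (hq : q ∈ Polynomial.degreeLT k l) :
    Polynomial.aeval x q ∈ riemannRochSpace (l • D) := by
  rw [Polynomial.aeval_eq_sum_range]
  refine Submodule.sum_mem _ fun i _ => ?_
  by_cases hi : q.coeff i = 0
  · rw [hi, zero_smul]; exact Submodule.zero_mem _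
  refine Submodule.smul_mem _ _ ?_
  refine riemannRochSpace_mono ?_ (pow_mem_riemannRochSpace hx i)
  have hlt : (i : WithBot ℕ) < l := (Polynomial.le_degree_of_ne_zero hi).trans_lt (Polynomial.mem_degreeLT.1 hq)
  exact nsmul_le_nsmul_left (Multiset.zero_le D) (by exact_mod_cast hlt.le)

end RiemannRochSpace

/-- A function without poles that vanishes at some place is zero: it is algebraic over `k`, since
the elements lying in all valuation rings that contain `k` are integral over `k`. -/
theorem eq_zero_of_forall_mem_ring (P : Place k F) {f : F} (hf : ∀ R : Place k F, f ∈ R.ring)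
    (hP : f ∈ P.ring.nonunits) : f = 0 := by
  by_contra hf0
  refine P.transcendental_of_mem_nonunits hf0 hP ?_
  have hint : f ∈ (integralClosure k F).toSubring := by
    by_contra hnot
    have : IsIntegrallyClosedIn (integralClosure k F).toSubring F :=
      inferInstanceAs (IsIntegrallyClosedIn (integralClosure k F) F)
    obtain ⟨V, hV, hfV⟩ := Subring.exists_le_valuationSubring_of_isIntegrallyClosedIn hnot
    exact hfV (hf ⟨V, fun c => hV ((integralClosure k F).algebraMap_mem c),
      fun htop => hfV (htop ▸ ValuationSubring.mem_top f)⟩)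
  exact IsIntegral.isAlgebraic hint

variable [Algebra (RatFunc k) F] [IsScalarTower k (RatFunc k) F] [FunctionField k F]

namespace Place

theorem hasPoleOrderLE_iff (P : Place k F) {ϖ : P.ring} (hϖ : Irreducible ϖ) (n : ℕ) (f : F) :
    P.HasPoleOrderLE n f ↔ (ϖ : F) ^ n * f ∈ P.ring := by
  refine ⟨fun h => h _ (ValuationSubring.coe_mem_nonunits_iff.2 hϖ.not_isUnit)
    (coe_ne_zero_of_irreducible hϖ), fun h t ht _ => ?_⟩
  have := P.isDiscreteValuationRing
  obtain ⟨htP, htm⟩ := ValuationSubring.mem_nonunits_iff_exists_mem_maximalIdeal.1 ht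
  rw [hϖ.maximalIdeal_eq, Ideal.mem_span_singleton] at htm
  obtain ⟨s, hs⟩ := htm
  have hts : t = ϖ * s := congrArg Subtype.val hs
  rw [hts, mul_pow, mul_comm ((ϖ : F) ^ n), mul_assoc]
  exact P.ring.mul_mem _ _ (pow_mem s.2 n) h

theorem hasPoleOrderLE_poleOrder (P : Place k F) (f : F) : P.HasPoleOrderLE (P.poleOrder f) f := by
  by_cases hf : f ∈ P.ring
  · exact P.hasPoleOrderLE_of_mem_ring _ hf
  have hf0 : f ≠ 0 := by rintro rfl; exact hf P.ring.zero_mem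
  obtain ⟨ϖ, hϖ⟩ := P.exists_irreducible
  rw [P.hasPoleOrderLE_iff hϖ]
  obtain ⟨n, u, rfl⟩ := P.exists_eq_mul_zpow hϖ hf0
  rw [poleOrder, if_neg hf, P.ord_unit_mul_zpow hϖ, ← zpow_natCast, mul_left_comm,
    ← zpow_add₀ (coe_ne_zero_of_irreducible hϖ), P.unit_mul_zpow_mem_ring_iff hϖ]
  omega

end Place

/-- `ℓ(D) ≤ deg D + 1` for effective `D`, in the presence of a rational place. -/
theorem rank_riemannRochSpace_le (P : Place k F) (hP : P.degree = 1)
    (D : Multiset (Place k F)) :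
    Module.rank k (riemannRochSpace D) ≤ (divisorDegree D + 1 : ℕ) := by
  classical
  induction D using Multiset.induction with
  | empty =>
    have hle : riemannRochSpace (0 : Multiset (Place k F)) ≤ Submodule.span k {1} := by
      intro f hf
      rw [mem_riemannRochSpace_zero] at hf
      have hval := P.algebraMap_eval hP f (hf P)
      rw [Submodule.mem_span_singleton]
      refine ⟨P.eval f, ?_⟩
      rw [← Algebra.algebraMap_eq_smul_one, ← sub_eq_zero]
      refine eq_zero_of_forall_mem_ring P (fun R => sub_mem (R.algebraMap_mem _) (hf R)) ?_
      have hres : IsLocalRing.residue P.ring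
          (⟨algebraMap k F (P.eval f), P.algebraMap_mem _⟩ - ⟨f, hf P⟩) = 0 := by
        rw [map_sub, sub_eq_zero, ← hval]
        rfl
      rw [IsLocalRing.residue_eq_zero_iff] at hres
      exact ValuationSubring.coe_mem_nonunits_iff.2 hres
    refine (Submodule.rank_mono hle).trans ((rank_span_le _).trans ?_)
    simp [divisorDegree]
  | cons R D ih =>
    obtain ⟨ϖ, hϖ⟩ := R.exists_irreducible
    have hreg : ∀ f : riemannRochSpace (R ::ₘ D), (ϖ : F) ^ (D.count R + 1) * f ∈ R.ring := by
      intro f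
      have h := f.2 R
      rwa [Multiset.count_cons_self, R.hasPoleOrderLE_iff hϖ] at h
    -- the leading coefficient at `R`, whose kernel is `L(D)`
    let lead : riemannRochSpace (R ::ₘ D) →ₗ[k] R.resField :=
      { toFun := fun f => IsLocalRing.residue R.ring ⟨(ϖ : F) ^ (D.count R + 1) * f, hreg f⟩
        map_add' := fun f g => by
          rw [← map_add]
          congr 1
          apply Subtype.ext
          simp [mul_add]
        map_smul' := fun c f => by
          rw [RingHom.id_apply, Algebra.smul_def,
            IsScalarTower.algebraMap_apply k R.ring R.resField,
            IsLocalRing.ResidueField.algebraMap_eq, ← map_mul]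
          congr 1
          apply Subtype.ext
          change (ϖ : F) ^ (D.count R + 1) * (c • (f : F)) = algebraMap k F c * (_ * (f : F))
          rw [Algebra.smul_def]
          exact mul_left_comm _ _ _ }
    have hker : (LinearMap.ker lead).map (riemannRochSpace (R ::ₘ D)).subtype ≤
        riemannRochSpace D := by
      rintro _ ⟨f, hf, rfl⟩ S
      by_cases hS : S = R
      · subst hS
        have h0 : IsLocalRing.residue S.ring
            ⟨(ϖ : F) ^ (D.count S + 1) * f, hreg f⟩ = 0 := hf
        have := S.isDiscreteValuationRing
        rw [IsLocalRing.residue_eq_zero_iff, hϖ.maximalIdeal_eq, Ideal.mem_span_singleton] at h0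
        obtain ⟨s, hs⟩ := h0
        have hs' : (ϖ : F) ^ (D.count S + 1) * f = ϖ * s := congrArg Subtype.val hs
        rw [pow_succ', mul_assoc] at hs'
        rw [S.hasPoleOrderLE_iff hϖ]
        have := mul_left_cancel₀ (Place.coe_ne_zero_of_irreducible hϖ) hs'
        rw [Submodule.subtype_apply, this]
        exact s.2
      · have h := f.2 S
        rwa [Multiset.count_cons_of_ne hS] at h
    have hkerrank : Module.rank k (LinearMap.ker lead) ≤ (divisorDegree D + 1 : ℕ) := by
      refine le_trans ?_ ((Submodule.rank_mono hker).trans ih)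
      exact ((Submodule.equivMapOfInjective _ (Submodule.subtype_injective _) _).rank_eq).le
    have := R.finite_resField
    have hran : Module.rank k (LinearMap.range lead) ≤ (R.degree : ℕ) := by
      refine (Submodule.rank_le _).trans ?_
      rw [Place.degree, Module.finrank_eq_rank]
    rw [← LinearMap.rank_range_add_rank_ker lead]
    refine (add_le_add hran hkerrank).trans ?_
    rw [← Nat.cast_add]
    simp [divisorDegree, add_assoc]

end

section

open Polynomial IntermediateField IntermediateField.algebraAdjoinAdjoin

variable [Algebra (RatFunc k) F] [IsScalarTower k (RatFunc k) F] [FunctionField k F]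

/-! ### Approximation at finitely many places -/

/-- By induction on `s`: if `y` works for `s` and `w` for one more place, then `y + w ^ r` works for
all of them once no cancellation of valuations occurs, which excludes finitely many `r`. -/
theorem exists_valuation_lt_one_forall_one_lt (P : Place k F) (s : Finset (Place k F))
    (hP : P ∉ s) : ∃ y : F, P.ring.valuation y < 1 ∧ ∀ R ∈ s, 1 < R.ring.valuation y := by
  classical
  induction s using Finset.induction_on with
  | empty => exact ⟨0, by simp, by simp⟩
  | insert N s _ ih =>
    obtain ⟨y, hyP, hys⟩ := ih fun h => hP (Finset.mem_insert_of_mem h)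
    have hPN : P ≠ N := fun h => hP (h ▸ Finset.mem_insert_self P s)
    obtain ⟨w, hwP, hwN⟩ : ∃ w : F, P.ring.valuation w < 1 ∧ 1 < N.ring.valuation w := by
      obtain ⟨a, haP, haN⟩ := Set.not_subset.1 fun h => hPN (P.eq_of_ring_le N h)
      obtain ⟨b, hbN, hbP⟩ := Set.not_subset.1 fun h => hPN (N.eq_of_ring_le P h).symm
      have haP' := (P.ring.valuation_le_one_iff a).2 haP
      have hbN' := (N.ring.valuation_le_one_iff b).2 hbN
      have haN' := not_le.1 (mt (N.ring.valuation_le_one_iff a).1 haN)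
      have hbP' := not_le.1 (mt (P.ring.valuation_le_one_iff b).1 hbP)
      have hb0 : b ≠ 0 := by rintro rfl; exact hbP P.ring.zero_mem
      refine ⟨a / b, ?_, ?_⟩
      · rw [map_div₀]
        exact (div_lt_one₀ (zero_lt_one.trans hbP')).2 (haP'.trans_lt hbP')
      · rw [map_div₀]
        exact (one_lt_div₀ (zero_lt_iff.2 ((Valuation.ne_zero_iff _).2 hb0))).2
          (hbN'.trans_lt haN')
    have hw0 : w ≠ 0 := by
      rintro rfl
      rw [map_zero] at hwN
      exact not_lt.2 zero_le_one hwN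
    -- at each of the places, at most one power of `w` has the same valuation as `y`
    have hbad : ∀ R ∈ insert N s, {r : ℕ | R.ring.valuation y = R.ring.valuation w ^ r}.Finite := by
      intro R hR
      by_cases h1 : R.ring.valuation w = 1
      · have hR' : R ∈ s := by
          refine (Finset.mem_insert.1 hR).resolve_left ?_
          rintro rfl
          exact hwN.ne' h1
        have hempty : {r : ℕ | R.ring.valuation y = R.ring.valuation w ^ r} = ∅ := by
          refine Set.eq_empty_of_forall_notMem fun r hr => ?_
          have hr' : R.ring.valuation y = R.ring.valuation w ^ r := hr
          rw [h1, one_pow] at hr'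
          exact (hys R hR').ne' hr'
        rw [hempty]
        exact Set.finite_empty
      · refine Set.Subsingleton.finite fun a ha b hb => ?_
        have hinj := pow_right_injective₀
          (zero_lt_iff.2 ((Valuation.ne_zero_iff R.ring.valuation).2 hw0)) h1
        exact hinj ((Eq.symm ha).trans hb)
    obtain ⟨r, hr⟩ := (((insert N s).finite_toSet.biUnion hbad).union
      (Set.finite_singleton 0)).exists_notMem
    rw [Set.mem_union, not_or, Set.mem_iUnion₂, Set.mem_singleton_iff] at hr
    obtain ⟨hr, hr0⟩ := hr
    refine ⟨y + w ^ r, ?_, fun R hR => ?_⟩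
    · refine Valuation.map_add_lt _ hyP ?_
      rw [map_pow]
      exact pow_lt_one₀ zero_le hwP hr0
    · have hne : R.ring.valuation y ≠ R.ring.valuation (w ^ r) := by
        rw [map_pow]
        exact fun h => hr ⟨R, hR, h⟩
      rw [Valuation.map_add_of_distinct_val _ hne, lt_max_iff]
      rcases Finset.mem_insert.1 hR with rfl | hR
      · right
        rw [map_pow]
        exact one_lt_pow₀ hwN hr0
      · exact Or.inl (hys R hR)

/-- There is a function that is congruent to `1` at `P` and to `0` at finitely many other
places. -/
theorem exists_sub_one_mem_nonunits (P : Place k F) (s : Finset (Place k F)) (hP : P ∉ s) :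
    ∃ e : F, e - 1 ∈ P.ring.nonunits ∧ ∀ R ∈ s, e ∈ R.ring.nonunits := by
  obtain ⟨y, hyP, hys⟩ := exists_valuation_lt_one_forall_one_lt P s hP
  have hval : P.ring.valuation (1 + y) = 1 := by
    rw [Valuation.map_add_eq_of_lt_left _ (by rwa [map_one]), map_one]
  have hy0 : 1 + y ≠ 0 := by
    intro h
    rw [h, map_zero] at hval
    exact zero_ne_one hval
  refine ⟨(1 + y)⁻¹, ?_, fun R hR => ?_⟩
  · have : (1 + y)⁻¹ - 1 = -(y * (1 + y)⁻¹) := by field_simp; ring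
    rw [this, ValuationSubring.mem_nonunits_iff, Valuation.map_neg, map_mul, map_inv₀, hval,
      inv_one, mul_one]
    exact hyP
  · rw [ValuationSubring.mem_nonunits_iff, map_inv₀,
      Valuation.map_add_eq_of_lt_right _ (by rw [map_one]; exact hys R hR)]
    exact inv_lt_one_of_one_lt₀ (hys R hR)

/-! ### Counting zeros -/

theorem finrank_riemannRochSpace_le (P : Place k F) (hP : P.degree = 1)
    (D : Multiset (Place k F)) :
    Module.Finite k (riemannRochSpace D) ∧
      Module.finrank k (riemannRochSpace D) ≤ divisorDegree D + 1 :=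
  have h := rank_riemannRochSpace_le P hP D
  ⟨Module.rank_lt_aleph0_iff.1 (h.trans_lt (Cardinal.natCast_lt_aleph0)),
    Module.finrank_le_of_rank_le h⟩

/-- A nonzero function has at most as many distinct zeros as the degree of any effective divisor
`B` that bounds its poles.  If `u_R`, for `R` in the set `Z` of zeros, are functions with
`u_R ≡ 1` at `R` and `u_R ≡ 0` at the other zeros, scaled so as to have poles only at poles of
`x`, then the functions `x ^ i * u_R` with `i < l` are linearly independent and lie in
`L((l + c) B)` for some `c` that does not depend on `l`, so `l * #Z ≤ (l + c) * deg B + 1`. -/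
theorem card_zeros_le (P : Place k F) (hP : P.degree = 1) {x : F} (hx0 : x ≠ 0)
    (B : Multiset (Place k F)) (hx : x ∈ riemannRochSpace B) (Z : Finset (Place k F))
    (hZ : ∀ R ∈ Z, x ∈ R.ring.nonunits) : Z.card ≤ divisorDegree B := by
  classical
  rcases Z.eq_empty_or_nonempty with rfl | ⟨R₀, hR₀⟩
  · simp
  have htr := R₀.transcendental_of_mem_nonunits hx0 (hZ R₀ hR₀)
  have := FunctionField.finiteDimensional_of_adjoin_transcendental htr
  choose u hu1 hu0 using fun R : Z => exists_sub_one_mem_nonunits R.1 (Z.erase R.1)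
    (Finset.notMem_erase _ _)
  have hureg : ∀ R S : Z, u R ∈ S.1.ring := by
    intro R S
    by_cases h : S = R
    · subst h
      have := add_mem (ValuationSubring.nonunits_subset (hu1 S)) S.1.ring.one_mem
      rwa [sub_add_cancel] at this
    · exact ValuationSubring.nonunits_subset
        (hu0 R S.1 (Finset.mem_erase.2 ⟨fun h' => h (Subtype.ext h'), S.2⟩))
  obtain ⟨y, hy0, hy⟩ := exists_integral_multiples (Algebra.adjoin k {x}) k⟮x⟯
    (Finset.univ.image u)
  have hy0' : (y : F) ≠ 0 := fun h => hy0 (Subtype.ext h)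
  have hind : ∀ φ : Z → k[X], ∑ R, aeval x (φ R) * ((y : F) * u R) = 0 → φ = 0 := by
    intro φ hφ
    refine eq_zero_of_sum_aeval_mul_eq_zero hx0 (⨅ S : Z, S.1.toSubmodule) ?_ u ?_ ?_ φ ?_
    · intro f hf
      rw [Submodule.mem_iInf] at hf ⊢
      exact fun S => S.1.ring.mul_mem _ _ (ValuationSubring.nonunits_subset (hZ S.1 S.2)) (hf S)
    · exact fun R => (Submodule.mem_iInf _).2 fun S => hureg R S
    · rintro c ⟨f, hf, hcf⟩
      rw [Submodule.mem_iInf] at hf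
      funext S
      -- modulo the maximal ideal of `S`, the relation reads `c S = 0`
      have hsum : ∑ R, c R • u R - algebraMap k F (c S) ∈ S.1.ring.nonunits := by
        rw [← Finset.add_sum_erase _ _ (Finset.mem_univ S), add_sub_right_comm]
        refine add_mem ?_ (sum_mem fun R hR => ?_)
        · have : c S • u S - algebraMap k F (c S) = (u S - 1) * algebraMap k F (c S) := by
            rw [Algebra.smul_def]; ring
          rw [this]
          exact S.1.mul_mem_nonunits (hu1 S) (S.1.algebraMap_mem _)
        · rw [Algebra.smul_def, mul_comm]
          refine S.1.mul_mem_nonunits (hu0 R S.1 (Finset.mem_erase.2 ⟨?_, S.2⟩))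
            (S.1.algebraMap_mem _)
          exact fun h => (Finset.mem_erase.1 hR).1 (Subtype.ext h).symm
      have hc : algebraMap k F (c S) ∈ S.1.ring.nonunits := by
        have h := sub_mem (hcf ▸ S.1.mul_mem_nonunits (hZ S.1 S.2) (hf S)) hsum
        rwa [sub_sub_cancel] at h
      by_contra hne
      exact S.1.transcendental_of_mem_nonunits ((_root_.map_ne_zero _).2 hne) hc
        (isAlgebraic_algebraMap (c S))
    · refine (mul_eq_zero.1 ?_).resolve_left hy0'
      rw [← hφ, Finset.mul_sum]
      exact Finset.sum_congr rfl fun R _ => mul_left_comm _ _ _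
  -- the `y * u R` are integral over `k[x]`, so they have poles only at poles of `x`
  set c := ∑ R : Z, ∑ S ∈ B.toFinset, S.poleOrder ((y : F) * u R)
  have hv : ∀ R : Z, (y : F) * u R ∈ riemannRochSpace (c • B) := by
    intro R S
    rw [Multiset.count_nsmul]
    by_cases hS : S ∈ B
    · refine (S.hasPoleOrderLE_poleOrder _).mono ?_
      refine le_trans ?_ (Nat.le_mul_of_pos_right c (Multiset.count_pos.2 hS))
      refine le_trans ?_ (Finset.single_le_sum (f := fun R : Z => ∑ S ∈ B.toFinset,
        S.poleOrder ((y : F) * u R)) (fun _ _ => Nat.zero_le _) (Finset.mem_univ R))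
      exact Finset.single_le_sum (f := fun S : Place k F => S.poleOrder ((y : F) * u R))
        (fun _ _ => Nat.zero_le _) (Multiset.mem_toFinset.2 hS)
    · refine S.hasPoleOrderLE_of_mem_ring _ (S.mem_ring_of_isIntegral_adjoin (x := x) ?_
        (hy _ (Finset.mem_image_of_mem u (Finset.mem_univ R))))
      have h := hx S
      rwa [Multiset.count_eq_zero_of_notMem hS, S.hasPoleOrderLE_zero_iff] at h
  have key : ∀ l : ℕ, Z.card * l ≤ (l + c) * divisorDegree B + 1 := by
    intro l
    let T : (Z → degreeLT k l) →ₗ[k] riemannRochSpace ((l + c) • B) :=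
      { toFun := fun φ => ⟨∑ R, aeval x (φ R : k[X]) * ((y : F) * u R), by
          rw [add_nsmul]
          exact Submodule.sum_mem _ fun R _ =>
            mul_mem_riemannRochSpace (aeval_mem_riemannRochSpace hx (φ R).2) (hv R)⟩
        map_add' := fun φ ψ => by
          apply Subtype.ext
          simp [add_mul, Finset.sum_add_distrib]
        map_smul' := fun a φ => by
          apply Subtype.ext
          simp [Finset.smul_sum] }
    have hT : Function.Injective T := by
      rw [← LinearMap.ker_eq_bot, LinearMap.ker_eq_bot']
      intro φ hφ
      have h0 := hind (fun R => φ R) (congrArg Subtype.val hφ)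
      funext R
      exact Subtype.ext (congrFun h0 R)
    obtain ⟨hfin, hle⟩ := finrank_riemannRochSpace_le P hP ((l + c) • B)
    have := (LinearMap.finrank_le_finrank_of_injective hT).trans hle
    rwa [Module.finrank_pi_fintype, Finset.sum_const, Finset.card_univ, Fintype.card_coe,
      (degreeLTEquiv k l).finrank_eq, Module.finrank_fin_fun, smul_eq_mul,
      divisorDegree_nsmul] at this
  -- for this `l`, the inequality `key` fails if `Z` has more than `deg B` elements
  by_contra hlt
  have h1 := key (c * divisorDegree B + 2)
  have h2 : (divisorDegree B + 1) * (c * divisorDegree B + 2) ≤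
      Z.card * (c * divisorDegree B + 2) := Nat.mul_le_mul_right _ (not_le.1 hlt)
  nlinarith

end

section

/-! ### Automorphisms acting on places -/

namespace Place

theorem map_mul (σ τ : F ≃ₐ[k] F) (P : Place k F) : P.map (σ * τ) = (P.map τ).map σ := rfl

theorem map_one (P : Place k F) : P.map (1 : F ≃ₐ[k] F) = P := rfl

theorem map_injective (σ : F ≃ₐ[k] F) : Function.Injective (map σ : Place k F → Place k F) := by
  intro P R h
  have h' := congrArg (map σ⁻¹) h
  rwa [← map_mul, ← map_mul, inv_mul_cancel, map_one, map_one] at h'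

theorem mem_map_nonunits (σ : F ≃ₐ[k] F) (P : Place k F) (f : F) :
    f ∈ (P.map σ).ring.nonunits ↔ σ⁻¹ f ∈ P.ring.nonunits := by
  rw [ValuationSubring.mem_nonunits_iff_or, ValuationSubring.mem_nonunits_iff_or, mem_map_ring,
    ← map_inv₀, map_eq_zero_iff _ (AlgEquiv.injective _)]
  rfl

theorem hasPoleOrderLE_map {σ : F ≃ₐ[k] F} {P : Place k F} {n : ℕ} {f : F}
    (h : P.HasPoleOrderLE n f) : (P.map σ).HasPoleOrderLE n (σ f) := by
  intro t ht ht0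
  rw [mem_map_nonunits] at ht
  have h' := h _ ht ((map_ne_zero_iff _ (AlgEquiv.injective _)).2 ht0)
  rw [mem_map_ring, _root_.map_mul, map_pow, AlgEquiv.symm_apply_apply]
  exact h'

/-- The isomorphism `𝒪_P ≅ 𝒪_{σ(P)}` induced by `σ`. -/
def ringEquivMap (σ : F ≃ₐ[k] F) (P : Place k F) : P.ring ≃+* (P.map σ).ring where
  toFun f := ⟨σ (f : F), by rw [mem_map_ring, AlgEquiv.symm_apply_apply]; exact f.2⟩
  invFun f := ⟨σ.symm (f : F), f.2⟩
  left_inv f := Subtype.ext (σ.symm_apply_apply f)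
  right_inv f := Subtype.ext (σ.apply_symm_apply f)
  map_mul' f g := Subtype.ext (_root_.map_mul σ (f : F) g)
  map_add' f g := Subtype.ext (_root_.map_add σ (f : F) g)

theorem degree_map (σ : F ≃ₐ[k] F) (P : Place k F) : (P.map σ).degree = P.degree := by
  let e := IsLocalRing.ResidueField.mapEquiv (P.ringEquivMap σ)
  have halg : ∀ c : k, e (algebraMap k P.resField c) = algebraMap k (P.map σ).resField c := by
    intro c
    have hc : P.ringEquivMap σ (algebraMap k P.ring c) = algebraMap k (P.map σ).ring c :=
      Subtype.ext (σ.commutes c)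
    rw [IsScalarTower.algebraMap_apply k P.ring P.resField,
      IsScalarTower.algebraMap_apply k (P.map σ).ring (P.map σ).resField, ← hc]
    rfl
  have e' : P.resField ≃ₗ[k] (P.map σ).resField :=
    { e with
      map_smul' := fun c a => by
        change e (c • a) = c • e a
        rw [Algebra.smul_def, Algebra.smul_def, _root_.map_mul, halg] }
  exact e'.finrank_eq.symm

theorem injOn_map_pow (σ : F ≃ₐ[k] F) (P : Place k F) {n : ℕ}
    (hn : IsLeast {i : ℕ | 0 < i ∧ P.map (σ ^ i) = P} n) :
    Set.InjOn (fun i : ℕ => P.map (σ ^ i)) (Set.Iio n) := by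
  have haux : ∀ i j : ℕ, i < j → j < n → P.map (σ ^ i) ≠ P.map (σ ^ j) := by
    intro i j hij hj h
    have h' : P.map (σ ^ (j - i)) = P := by
      apply map_injective (σ ^ i)
      rw [← map_mul, ← pow_add, h, Nat.add_sub_cancel' hij.le]
    have := hn.2 ⟨Nat.sub_pos_of_lt hij, h'⟩
    omega
  intro i hi j hj h
  rcases lt_trichotomy i j with hij | hij | hij
  · exact absurd h (haux i j hij hj)
  · exact hij
  · exact absurd h.symm (haux j i hij hi)

/-! ### Values of functions -/

/-- `f` is regular at `P` with value `c ∈ k`. -/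
def HasValue (P : Place k F) (f : F) (c : k) : Prop :=
  f - algebraMap k F c ∈ P.ring.nonunits

theorem HasValue.mem_ring {P : Place k F} {f : F} {c : k} (h : P.HasValue f c) : f ∈ P.ring := by
  have := add_mem (ValuationSubring.nonunits_subset h) (P.algebraMap_mem c)
  rwa [sub_add_cancel] at this

theorem hasValue_iff (P : Place k F) {f : F} (hf : f ∈ P.ring) (c : k) :
    P.HasValue f c ↔ algebraMap k P.resField c = IsLocalRing.residue P.ring ⟨f, hf⟩ := by
  rw [IsScalarTower.algebraMap_apply k P.ring P.resField, IsLocalRing.ResidueField.algebraMap_eq,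
    eq_comm, ← sub_eq_zero, ← map_sub, IsLocalRing.residue_eq_zero_iff,
    ← ValuationSubring.coe_mem_nonunits_iff]
  rfl

theorem HasValue.eval_eq {P : Place k F} {f : F} {c : k} (h : P.HasValue f c) :
    P.eval f = c := by
  have hex : ∃ c : k, ∃ hf : f ∈ P.ring,
      algebraMap k P.resField c = IsLocalRing.residue P.ring ⟨f, hf⟩ :=
    ⟨c, h.mem_ring, (P.hasValue_iff h.mem_ring c).1 h⟩
  rw [eval, dif_pos hex]
  obtain ⟨hf, hval⟩ := hex.choose_spec
  exact (algebraMap k P.resField).injective (hval.trans ((P.hasValue_iff hf c).1 h).symm)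

theorem exists_hasValue {P : Place k F} (hP : P.degree = 1) {f : F} (hf : f ∈ P.ring) :
    ∃ c, P.HasValue f c :=
  ⟨P.eval f, (P.hasValue_iff hf _).2 (P.algebraMap_eval hP f hf)⟩

theorem hasValue_algebraMap (P : Place k F) (c : k) : P.HasValue (algebraMap k F c) c := by
  rw [HasValue, sub_self]
  exact P.ring.nonunits.zero_mem

theorem HasValue.add {P : Place k F} {f g : F} {c d : k} (hf : P.HasValue f c)
    (hg : P.HasValue g d) : P.HasValue (f + g) (c + d) := by
  have h := add_mem hf hg
  rwa [← add_sub_add_comm, ← _root_.map_add] at h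

theorem HasValue.mul {P : Place k F} {f g : F} {c d : k} (hf : P.HasValue f c)
    (hg : P.HasValue g d) : P.HasValue (f * g) (c * d) := by
  have h := add_mem (P.mul_mem_nonunits hf hg.mem_ring) (P.mul_mem_nonunits hg (P.algebraMap_mem c))
  have heq : f * g - algebraMap k F (c * d) =
      (f - algebraMap k F c) * g + (g - algebraMap k F d) * algebraMap k F c := by
    rw [_root_.map_mul]; ring
  rwa [HasValue, heq]

theorem HasValue.pow {P : Place k F} {f : F} {c : k} (hf : P.HasValue f c) (n : ℕ) :
    P.HasValue (f ^ n) (c ^ n) := by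
  induction n with
  | zero => simpa using P.hasValue_algebraMap 1
  | succ n ih => rw [pow_succ, pow_succ]; exact ih.mul hf

theorem HasValue.sum {P : Place k F} {ι : Type*} (s : Finset ι) {f : ι → F} {c : ι → k}
    (h : ∀ i ∈ s, P.HasValue (f i) (c i)) : P.HasValue (∑ i ∈ s, f i) (∑ i ∈ s, c i) := by
  rw [HasValue, map_sum, ← Finset.sum_sub_distrib]
  exact sum_mem h

theorem HasValue.aeval {P : Place k F} {ι : Type*} {f : ι → F} {c : ι → k}
    (h : ∀ i, P.HasValue (f i) (c i)) (Φ : MvPolynomial ι k) :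
    P.HasValue (MvPolynomial.aeval f Φ) (MvPolynomial.eval c Φ) := by
  induction Φ using MvPolynomial.induction_on with
  | C a => simpa using P.hasValue_algebraMap a
  | add p q hp hq => rw [_root_.map_add, _root_.map_add]; exact hp.add hq
  | mul_X p i hp =>
    rw [_root_.map_mul, _root_.map_mul, MvPolynomial.aeval_X, MvPolynomial.eval_X]
    exact hp.mul (h i)

theorem hasValue_map_iff (σ : F ≃ₐ[k] F) (P : Place k F) (f : F) (c : k) :
    (P.map σ).HasValue f c ↔ P.HasValue (σ⁻¹ f) c := by
  rw [HasValue, HasValue, mem_map_nonunits, map_sub, AlgEquiv.commutes]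

end Place

/-! ### Images of Riemann–Roch spaces -/

theorem map_mem_riemannRochSpace (σ : F ≃ₐ[k] F) {D : Multiset (Place k F)} {f : F}
    (hf : f ∈ riemannRochSpace D) : σ f ∈ riemannRochSpace (D.map (Place.map σ)) := by
  classical
  intro R
  have hR : R = (R.map σ⁻¹).map σ := by
    rw [← Place.map_mul, mul_inv_cancel, Place.map_one]
  rw [hR, Multiset.count_map_eq_count' _ _ (Place.map_injective σ)]
  exact Place.hasPoleOrderLE_map (hf _)

theorem mvAeval_mem_riemannRochSpace {ι : Type*} [Fintype ι] (f : ι → F)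
    (D : ι → Multiset (Place k F)) (hf : ∀ i, f i ∈ riemannRochSpace (D i)) {m : ℕ}
    (Φ : MvPolynomial ι k) (hΦ : Φ.totalDegree ≤ m) :
    MvPolynomial.aeval f Φ ∈ riemannRochSpace (∑ i, m • D i) := by
  rw [MvPolynomial.aeval_def, MvPolynomial.eval₂_eq']
  refine Submodule.sum_mem _ fun e he => ?_
  rw [← Algebra.smul_def]
  refine Submodule.smul_mem _ _ ?_
  refine riemannRochSpace_mono ?_ (prod_mem_riemannRochSpace Finset.univ _ (fun i => e i • D i)
    fun i _ => pow_mem_riemannRochSpace (hf i) (e i))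
  refine Finset.sum_le_sum fun i _ => nsmul_le_nsmul_left (Multiset.zero_le _) ?_
  refine le_trans ?_ ((MvPolynomial.le_totalDegree he).trans hΦ)
  rw [Finsupp.sum_fintype _ _ fun _ => rfl]
  exact Finset.single_le_sum (f := fun i => e i) (fun _ _ => Nat.zero_le _) (Finset.mem_univ i)

/-! ### The trace as a function -/

/-- The absolute trace on a field of order `p ^ h` is `x ↦ ∑ i < h, x ^ (p ^ i)`. -/
theorem algebraMap_trace_eq_sum_range {p h : ℕ} [Fact p.Prime] [Finite k] [Algebra (ZMod p) k]
    (hq : Nat.card k = p ^ h) (x : k) :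
    algebraMap (ZMod p) k (Algebra.trace (ZMod p) k x) = ∑ i ∈ Finset.range h, x ^ p ^ i := by
  have hfr : Module.finrank (ZMod p) k = h := by
    have h1 := Module.natCard_eq_pow_finrank (K := ZMod p) (V := k)
    rw [hq, Nat.card_zmod] at h1
    exact (Nat.pow_right_injective (Fact.out : p.Prime).two_le h1).symm
  rw [FiniteField.algebraMap_trace_eq_sum_pow, hfr, Nat.card_zmod]

theorem sum_pow_notMem_ring {p h : ℕ} (hp : 1 < p) (hh : 0 < h) (Q : Place k F) {z : F}
    (hz : z ∉ Q.ring) : ∑ i ∈ Finset.range h, z ^ p ^ i ∉ Q.ring := by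
  obtain ⟨h, rfl⟩ := Nat.exists_eq_succ_of_ne_zero hh.ne'
  have hv : 1 < Q.ring.valuation z := not_le.1 (mt (Q.ring.valuation_le_one_iff z).1 hz)
  have hlt : Q.ring.valuation (∑ i ∈ Finset.range h, z ^ p ^ i) <
      Q.ring.valuation (z ^ p ^ h) := by
    refine Valuation.map_sum_lt _ ?_ fun i hi => ?_
    · rw [map_pow]
      exact pow_ne_zero _ (zero_lt_one.trans hv).ne'
    · rw [map_pow, map_pow]
      exact pow_lt_pow_right₀ hv (Nat.pow_lt_pow_right hp (Finset.mem_range.1 hi))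
  rw [← ValuationSubring.valuation_le_one_iff, Finset.sum_range_succ,
    Valuation.map_add_eq_of_lt_right _ hlt, map_pow, not_le]
  exact one_lt_pow₀ hv (pow_pos (zero_lt_one.trans hp) h).ne'

theorem sum_pow_mem_riemannRochSpace {p : ℕ} (hp : 0 < p) (h : ℕ) {D : Multiset (Place k F)}
    {z : F} (hz : z ∈ riemannRochSpace D) :
    ∑ i ∈ Finset.range h, z ^ p ^ i ∈ riemannRochSpace (p ^ (h - 1) • D) := by
  refine Submodule.sum_mem _ fun i hi => ?_
  refine riemannRochSpace_mono ?_ (pow_mem_riemannRochSpace hz (p ^ i))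
  have := Finset.mem_range.1 hi
  exact nsmul_le_nsmul_left (Multiset.zero_le D) (Nat.pow_le_pow_right hp (by omega))

/-! ### Generating polynomials -/

/-- The nonlinear complexity is attained.  For the zero sequence the generating polynomial is the
zero polynomial in no variables. -/
theorem exists_generates_nonlinearComplexity {N : ℕ} (hN : 0 < N) (m : ℕ) (s : Fin N → k) :
    ∃ Φ : MvPolynomial (Fin (nonlinearComplexity m s)) k, Φ.totalDegree ≤ m ∧ Generates Φ s := by
  by_cases hs : s = 0
  · exact ⟨0, by simp, fun i hi => by simp [hs]⟩
  · have hmem : nonlinearComplexity m s ∈ {L : ℕ | 0 < L ∧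
        ∃ Φ : MvPolynomial (Fin L) k, Φ.totalDegree ≤ m ∧ Generates Φ s} := by
      rw [nonlinearComplexity, if_neg hs]
      refine Nat.sInf_mem ⟨N, hN, 0, by simp, fun i hi => ?_⟩
      omega
    exact hmem.2

variable [Algebra (RatFunc k) F] [IsScalarTower k (RatFunc k) F] [FunctionField k F]

/-- If the values of `w` along the orbit of a rational place `P` satisfy the recursion
`s_{i+L} = Φ(s_i, …, s_{i+L-1})`, then the function `σ⁻ᴸ w - Φ(w, σ⁻¹ w, …, σ¹⁻ᴸ w)` vanishes at
the places `P_0, …, P_{n-1-L}`.  It is not the zero function, as `σ⁻ᴸ w` is the only term with a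
pole at `σ⁻ᴸ(Q)`.  Comparing the number of zeros with the degree of the poles bounds `n`. -/
theorem le_of_generates (σ : F ≃ₐ[k] F) (P : Place k F) (hP : P.degree = 1) {n : ℕ}
    (hn : IsLeast {i : ℕ | 0 < i ∧ P.map (σ ^ i) = P} n) (Q : Place k F)
    (hdist : ∀ i < n, ∀ j < n, Q.map (σ ^ i) = Q.map (σ ^ j) → i = j) {w : F} {c : ℕ}
    (hw : w ∈ riemannRochSpace (c • {Q})) (hwQ : w ∉ Q.ring) (s : Fin n → k)
    (hs : ∀ i : Fin n, (P.map (σ ^ (i : ℕ))).HasValue w (s i)) {m L : ℕ}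
    (Φ : MvPolynomial (Fin L) k) (hΦ : Φ.totalDegree ≤ m) (hgen : Generates Φ s) :
    n ≤ L + (1 + L * m) * (c * Q.degree) := by
  classical
  rcases le_or_gt n L with hL | hL
  · exact hL.trans (Nat.le_add_right _ _)
  have hwj : ∀ j : ℕ, (σ ^ j)⁻¹ w ∈ riemannRochSpace (c • {Q.map (σ ^ j)⁻¹}) := fun j => by
    have h := map_mem_riemannRochSpace (σ ^ j)⁻¹ hw
    rwa [Multiset.map_nsmul, Multiset.map_singleton] at h
  have hreg : ∀ j < L, (σ ^ j)⁻¹ w ∈ (Q.map (σ ^ L)⁻¹).ring := by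
    intro j hj
    have hne : Q.map (σ ^ L)⁻¹ ≠ Q.map (σ ^ j)⁻¹ := by
      intro h
      have h' := congrArg (Place.map (σ ^ (L + j))) h
      rw [← Place.map_mul, ← Place.map_mul, pow_add, mul_inv_cancel_right, ← pow_add,
        add_comm L j, pow_add, mul_inv_cancel_right] at h'
      exact hj.ne (hdist j (hj.trans hL) L hL h')
    have h := hwj j (Q.map (σ ^ L)⁻¹)
    rwa [Multiset.count_nsmul, Multiset.count_singleton, if_neg hne, mul_zero,
      Place.hasPoleOrderLE_zero_iff] at h
  have hpole : (σ ^ L)⁻¹ w ∉ (Q.map (σ ^ L)⁻¹).ring := by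
    rwa [Place.mem_map_ring, AlgEquiv.symm_apply_apply]
  set W := (σ ^ L)⁻¹ w - MvPolynomial.aeval (fun j : Fin L => (σ ^ (j : ℕ))⁻¹ w) Φ with hW
  have hW0 : W ≠ 0 := by
    intro h0
    have hΦreg : MvPolynomial.aeval (fun j : Fin L => (σ ^ (j : ℕ))⁻¹ w) Φ ∈
        (Q.map (σ ^ L)⁻¹).ring := by
      rw [MvPolynomial.aeval_def, MvPolynomial.eval₂_eq']
      exact sum_mem fun e _ => mul_mem (Place.algebraMap_mem _ _)
        (prod_mem fun j _ => pow_mem (hreg j j.2) _)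
    rw [hW, sub_eq_zero] at h0
    exact hpole (h0 ▸ hΦreg)
  have hWmem : W ∈ riemannRochSpace (c • {Q.map (σ ^ L)⁻¹} +
      ∑ j : Fin L, m • c • ({Q.map (σ ^ (j : ℕ))⁻¹} : Multiset (Place k F))) :=
    Submodule.sub_mem _ (riemannRochSpace_mono (Multiset.le_add_right _ _) (hwj L))
      (riemannRochSpace_mono (Multiset.le_add_left _ _)
        (mvAeval_mem_riemannRochSpace _ (fun j : Fin L => c • {Q.map (σ ^ (j : ℕ))⁻¹})
          (fun j => hwj j) Φ hΦ))
  have hinj := (Place.injOn_map_pow σ P hn).mono (s₁ := ↑(Finset.range (n - L))) fun i hi => by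
    rw [Finset.coe_range, Set.mem_Iio] at hi
    exact hi.trans_le (Nat.sub_le n L)
  have hzero : ∀ R ∈ (Finset.range (n - L)).image (fun i : ℕ => P.map (σ ^ i)),
      W ∈ R.ring.nonunits := by
    intro R hR
    obtain ⟨i, hi, rfl⟩ := Finset.mem_image.1 hR
    have hiL : i + L < n := by have := Finset.mem_range.1 hi; omega
    have hval : ∀ j (hj : i + j < n),
        (P.map (σ ^ i)).HasValue ((σ ^ j)⁻¹ w) (s ⟨i + j, hj⟩) := by
      intro j hj
      rw [← Place.hasValue_map_iff, ← Place.map_mul, ← pow_add, add_comm j i]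
      exact hs ⟨i + j, hj⟩
    have h1 := hval L hiL
    have h2 := Place.HasValue.aeval
      (fun j : Fin L => hval j (lt_trans (Nat.add_lt_add_left j.2 i) hiL)) Φ
    rw [← hgen i hiL] at h2
    have h3 := sub_mem h1 h2
    rwa [sub_sub_sub_cancel_right] at h3
  have hcard := card_zeros_le P hP hW0 _ hWmem _ hzero
  rw [Finset.card_image_of_injOn hinj, Finset.card_range, divisorDegree_add, divisorDegree_nsmul,
    divisorDegree_singleton, Place.degree_map] at hcard
  have hsum : divisorDegree (∑ j : Fin L, m • c • ({Q.map (σ ^ (j : ℕ))⁻¹} : Multiset (Place k F)))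
      = L * (m * (c * Q.degree)) := by
    simp [divisorDegree_sum, Place.degree_map]
  rw [hsum] at hcard
  have : (1 + L * m) * (c * Q.degree) = c * Q.degree + L * (m * (c * Q.degree)) := by ring
  omega

/-! ### The two forms of the bound -/

theorem poleDivisorDegree_eq (z : F) (Q : Place k F)
    (hQ : ∀ R : Place k F, R ≠ Q → z ∈ R.ring) :
    poleDivisorDegree k z = Q.poleOrder z * Q.degree := by
  refine finsum_eq_single _ Q fun R hR => ?_
  rw [(R.poleOrder_eq_zero_iff z).2 (hQ R hR), zero_mul]

/-- From `n ≤ L + (1 + L * m) * c` to the quotient form of the bound, for every `C ≥ c`. -/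
theorem sub_div_le_of_le {n L m c : ℕ} {C : ℝ} (h : n ≤ L + (1 + L * m) * c) (hC : (c : ℝ) ≤ C) :
    ((n : ℝ) - C) / (1 + m * C) ≤ L := by
  have hC0 : 0 ≤ C := (Nat.cast_nonneg c).trans hC
  rw [div_le_iff₀ (by positivity)]
  have h' : (n : ℝ) ≤ L + (1 + L * m) * c := by exact_mod_cast h
  have h'' : (1 + (L : ℝ) * m) * c ≤ (1 + L * m) * C :=
    mul_le_mul_of_nonneg_left hC (by positivity)
  linarith

end

end FunctionFieldSeq

end

theorem mainTheorem4 (p h : ℕ) [Fact p.Prime]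
    {k : Type*} [Field k] [Finite k] [Algebra (ZMod p) k] (hq : Nat.card k = p ^ h)
    {F : Type*} [Field F] [Algebra k F]
    [Algebra (RatFunc k) F] [IsScalarTower k (RatFunc k) F] [FunctionField k F]
    (σ : F ≃ₐ[k] F)
    (P : FunctionFieldSeq.Place k F) (hP : P.degree = 1)
    (n : ℕ) (hn : IsLeast {i : ℕ | 0 < i ∧ P.map (σ ^ i) = P} n)
    (z : F) (hz : ∀ i : ℤ, 0 ≤ (P.map (σ ^ i)).ord z)
    (Q : FunctionFieldSeq.Place k F) (hQ : Q.ord z < 0)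
    (hQ' : ∀ R : FunctionFieldSeq.Place k F, R ≠ Q → 0 ≤ R.ord z)
    (hcop : Int.gcd (Q.ord z) p = 1)
    (hdist : ∀ i < n, ∀ j < n, Q.map (σ ^ i) = Q.map (σ ^ j) → i = j)
    (m : ℕ) :
    -- the bound with `d = deg Q`, for `s_z` as a sequence over `k ⊇ 𝔽_p`
    ((n : ℝ) - (p : ℝ) ^ (h - 1) * Q.reducedPoleOrder p z * Q.degree) /
        (1 + m * (p : ℝ) ^ (h - 1) * Q.reducedPoleOrder p z * Q.degree) ≤
      FunctionFieldSeq.nonlinearComplexity m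
        (fun i => algebraMap (ZMod p) k (FunctionFieldSeq.seqOf p σ P z n i)) ∧
    -- the bound with `d = deg (z)_∞`
    ((n : ℝ) - (p : ℝ) ^ (h - 1) * Q.reducedPoleOrder p z *
          FunctionFieldSeq.poleDivisorDegree k z) /
        (1 + m * (p : ℝ) ^ (h - 1) * Q.reducedPoleOrder p z *
          FunctionFieldSeq.poleDivisorDegree k z) ≤
      FunctionFieldSeq.nonlinearComplexity m
        (fun i => algebraMap (ZMod p) k (FunctionFieldSeq.seqOf p σ P z n i)) := by
  open FunctionFieldSeq in
  classical
  have hp : p.Prime := Fact.out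
  have hh : 0 < h := by
    rcases Nat.eq_zero_or_pos h with rfl | hh
    · exact absurd (hq.trans (pow_zero p)) Finite.one_lt_card.ne'
    · exact hh
  have hzQ : z ∉ Q.ring := Q.not_mem_ring_of_ord_neg hQ
  have hzR : ∀ R : Place k F, R ≠ Q → z ∈ R.ring := fun R hR => R.mem_ring_of_ord_nonneg (hQ' R hR)
  have hzmem : z ∈ riemannRochSpace (Q.poleOrder z • {Q}) := by
    intro R
    rw [Multiset.count_nsmul, Multiset.count_singleton]
    split_ifs with hR
    · rw [hR, mul_one]
      exact Q.hasPoleOrderLE_poleOrder z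
    · exact R.hasPoleOrderLE_of_mem_ring _ (hzR R hR)
  have hwmem := sum_pow_mem_riemannRochSpace hp.pos h hzmem
  rw [smul_smul] at hwmem
  have hvalue : ∀ i : Fin n, (P.map (σ ^ (i : ℕ))).HasValue (∑ j ∈ Finset.range h, z ^ p ^ j)
      (algebraMap (ZMod p) k (seqOf p σ P z n i)) := by
    intro i
    have hzi : z ∈ (P.map (σ ^ (i : ℕ))).ring := by
      have := hz (i : ℕ)
      rw [zpow_natCast] at this
      exact (P.map (σ ^ (i : ℕ))).mem_ring_of_ord_nonneg this
    obtain ⟨c, hc⟩ := Place.exists_hasValue ((Place.degree_map _ P).trans hP) hzi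
    rw [seqOf, hc.eval_eq, algebraMap_trace_eq_sum_range hq]
    exact Place.HasValue.sum _ fun j _ => hc.pow _
  obtain ⟨Φ, hΦ, hgen⟩ := exists_generates_nonlinearComplexity hn.1.1 m
    (fun i => algebraMap (ZMod p) k (seqOf p σ P z n i))
  have hbound := le_of_generates σ P hP hn Q hdist hwmem
    (sum_pow_notMem_ring hp.one_lt hh Q hzQ) _ hvalue Φ hΦ hgen
  have hpole : Q.poleOrder z ≤ Q.reducedPoleOrder p z := by
    have := Q.neg_ord_le_reducedPoleOrder hp z hQ hcop
    rw [Place.poleOrder, if_neg hzQ]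
    omega
  have hd : Q.degree ≤ poleDivisorDegree k z := by
    rw [poleDivisorDegree_eq z Q hzR]
    refine Nat.le_mul_of_pos_left _ (Nat.pos_of_ne_zero ?_)
    rwa [Ne, Q.poleOrder_eq_zero_iff]
  have hC : ∀ d : ℕ, Q.degree ≤ d → ((p ^ (h - 1) * Q.poleOrder z * Q.degree : ℕ) : ℝ) ≤
      (p : ℝ) ^ (h - 1) * Q.reducedPoleOrder p z * d := by
    intro d hd
    exact_mod_cast Nat.mul_le_mul (Nat.mul_le_mul_left _ hpole) hd
  constructor
  · have := sub_div_le_of_le hbound (hC _ le_rfl)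
    rwa [← mul_assoc, ← mul_assoc] at this
  · have := sub_div_le_of_le hbound (hC _ hd)
    rwa [← mul_assoc, ← mul_assoc] at this
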